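/- Let $X$ be an infinite regular cardinal, with its well-order $<$. Let $\mathcal O=\bigcup_{n\ge 1}\mathcal O^{(n)}$ be the set of all finitary operations on $X$, where $\mathcal O^{(n)}$ is the set of all functions $X^n\to X$. A clone is a subset of $\mathcal O$ that contains all projections and is closed under composition, and $\langle \mathcal F\rangle$ denotes the smallest clone containing $\mathcal F\subseteq\mathcal O$. For $\mathcal C\subseteq\mathcal O$ put $\mathcal C^{(n)}=\mathcal C\cap\mathcal O^{(n)}$. A set $S\subseteq X$ is small if $|S|<|X|$. A function $f\in\mathcal O^{(n)}$ is almost unary if there are $1\le k\le n$ and a map $F$ assigning to each element of $X$ a small subset of $X$ such that $f(x_1,\dots,x_n)\in F(x_k)$ for all $(x_1,\dots,x_n)\in X^n$. Let $\mathcal U$ be the set of all almost unary functions and $T_1=\mathcal U^{(2)}$. Let $\mathrm{Pol}(T_1)$ be the set of all $f\in\mathcal O$ that preserve $T_1$, i.e. $f(g_1,\dots,g_n)\in T_1$ whenever $f$ is $n$-ary and $g_1,\dots,g_n\in T_1$. For $n\ge 2$ let $m^n_2\in\mathcal O^{(n)}$ be the function that returns the second smallest entry of an $n$-tuple (entries counted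 with multiplicity), and put $\mathcal M_n=\langle\{m^n_2\}\cup T_1\rangle$. Theorem. The sequence $(\mathcal M_n)_{n\ge 2}$ forms a countably infinite descending chain: $$\mathcal O=\mathcal M_2\supsetneq\mathcal M_3=\mathrm{Pol}(T_1)\supsetneq\mathcal M_4\supsetneq\dots\supsetneq\mathcal M_n\supsetneq\mathcal M_{n+1}\supsetneq\dots$$ Moreover, $$\bigcap_{n\ge 2}\mathcal M_n=\mathcal U .$$ In addition, $\mathcal M_n^{(k)}=\mathcal U^{(k)}$ for all $n\ge 2$ and $1\le k<n$. -/

import Mathlib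

universe u

namespace AlmostUnary

open Cardinal

/-- Operations on `X`: an arity together with a function of that arity. -/
abbrev Op (X : Type u) : Type u := Σ n : ℕ, (Fin n → X) → X

variable {X : Type u}

/-- The set `O` of all finitary operations on `X`; all arities are at least `1`. -/
def allOps (X : Type u) : Set (Op X) := {f | 1 ≤ f.1}

/-- The `n`-ary part `C^(n)` of a set `C` of operations. -/
def arityPart (C : Set (Op X)) (n : ℕ) : Set ((Fin n → X) → X) := {f | (⟨n, f⟩ : Op X) ∈ C}

/-- A clone: a set of finitary operations (of positive arity) that contains all projections and is
closed under composition. -/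
structure IsClone (C : Set (Op X)) : Prop where
  subset_allOps : C ⊆ allOps X
  proj_mem : ∀ (n : ℕ) (i : Fin n), (⟨n, fun x => x i⟩ : Op X) ∈ C
  comp_mem : ∀ (n m : ℕ) (f : (Fin n → X) → X) (g : Fin n → (Fin m → X) → X),
    (⟨n, f⟩ : Op X) ∈ C → (∀ i, (⟨m, g i⟩ : Op X) ∈ C) →
      (⟨m, fun x => f (fun i => g i x)⟩ : Op X) ∈ C

/-- The clone `⟨F⟩` generated by `F`: the intersection of all clones that contain `F`. -/
def cloneGen (F : Set (Op X)) : Set (Op X) := ⋂₀ {C | IsClone C ∧ F ⊆ C}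

theorem isClone_allOps : IsClone (allOps X) where
  subset_allOps := subset_rfl
  proj_mem n i := by
    have := i.isLt
    change 1 ≤ n
    omega
  comp_mem n m f g hf hg := hg ⟨0, hf⟩

/-- The generated clone is indeed a clone. -/
theorem isClone_cloneGen {F : Set (Op X)} (hF : F ⊆ allOps X) : IsClone (cloneGen F) where
  subset_allOps := Set.sInter_subset_of_mem ⟨isClone_allOps, hF⟩
  proj_mem n i C hC := hC.1.proj_mem n i
  comp_mem n m f g hf hg C hC := hC.1.comp_mem n m f g (hf C hC) fun i => hg i C hC

/-- The polymorphisms of a relation `ρ ⊆ X^J`: the finitary operations that preserve `ρ`. -/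
def pol {J : Type u} (ρ : Set (J → X)) : Set (Op X) :=
  {f | f ∈ allOps X ∧ ∀ r : Fin f.1 → J → X, (∀ i, r i ∈ ρ) →
    (fun j => f.2 (fun i => r i j)) ∈ ρ}

/-- A subset of `X` is small if its cardinality is less than that of `X`. -/
def IsSmall (S : Set X) : Prop := #S < #X

/-- `f` is almost unary: one of its variables determines its value up to a small set. -/
def IsAlmostUnary {n : ℕ} (f : (Fin n → X) → X) : Prop :=
  ∃ (F : X → Set X) (k : Fin n), (∀ x, IsSmall (F x)) ∧ ∀ x : Fin n → X, f x ∈ F (x k)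

/-- The set `U` of all almost unary operations. -/
def almostUnary (X : Type u) : Set (Op X) := {f | IsAlmostUnary f.2}

/-- `T₁`, the set of all binary almost unary functions. -/
def T₁ (X : Type u) : Set ((Fin 2 → X) → X) := arityPart (almostUnary X) 2

/-- The `k`-th smallest entry of an `n`-tuple, where `k` is counted from `0`: the entry at
position `k` after the tuple has been sorted in increasing order. -/
def kthSmallest [LinearOrder X] {n : ℕ} (k : Fin n) : (Fin n → X) → X :=
  fun x => x (Tuple.sort x k)

/-- `kthSmallest k x = x (σ k)` whenever `x (σ 0) ≤ x (σ 1) ≤ …`. -/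
theorem kthSmallest_eq [LinearOrder X] {n : ℕ} (k : Fin n) (x : Fin n → X)
    (σ : Equiv.Perm (Fin n)) (hσ : Monotone (x ∘ σ)) : kthSmallest k x = x (σ k) :=
  congrFun (Tuple.unique_monotone (Tuple.monotone_sort x) hσ) k

/-- The clone `M_n = ⟨{m} ∪ T₁⟩`, for `n ≥ 2`, where `m` returns the second smallest entry of an
`n`-tuple. -/
def M (X : Type u) [LinearOrder X] (n : ℕ) (hn : 2 ≤ n) : Set (Op X) :=
  cloneGen ({(⟨n, kthSmallest ⟨1, hn⟩⟩ : Op X)} ∪ Sigma.mk 2 '' T₁ X)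

end AlmostUnary

/-!
Write `κ = #X`. As `κ` is regular and `X` has order type `κ`, a subset of `X` is small if and only if
it is bounded, and small unions of small sets are small.

Every clone `C` containing `T₁` contains all almost unary operations: for `f x ∈ F (x 0)`, code the
pair `{x 0, x 1}` by one element bounded in terms of the larger of the two, treat the cases
`x 1 ≤ x 0` and `x 0 < x 1` by operations of smaller arity, and join the two results by a function
in `T₁` (`comp_mem_of_dominated`). Consequently `C` is closed under domination: `f ∈ C` as soon as
`f x ∈ F (g x)` with `g ∈ C` and small sets `F y`.

A set `S` of variables *controls* `f` if bounding the variables in `S` bounds `f`. The key result,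
`mem_of_not_cover`, is a converse to the obvious invariants: if `C` also contains the second
smallest entry of `n`-tuples, and if fewer than `n` non-controlling sets never cover all variables
of `f`, then `f ∈ C`. This is a Baker–Pixley argument. Say that `g` avoids `S` if `g x` is always
at least some `x i` with `i ∉ S`. A variable outside all sets of a small family avoids them all, and
if `g₁, …, gₙ` each avoid all but one set of a family, with `n` distinct exceptions, then their
second smallest value avoids the whole family. So some `g ∈ C` avoids every non-controlling set.
Then `{i | x i ≤ g x}` is not avoided by `g`, so it controls `f`, which places `f x` in a small set
depending only on `g x`.

The equalities `M₂ = O` and `M₃ = Pol T₁` and the inclusions `Mₙ₊₁ ⊆ Mₙ` are instances of this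
criterion. In the opposite direction, for `k < n` the second smallest of `n` almost unary `k`-ary
functions is almost unary, because two of them depend on the same variable
(`isAlmostUnary_kthSmallest_comp`). Hence `Mₙ` preserves the `k`-ary almost unary functions, so its
`k`-ary members are almost unary; this gives strictness and the intersection.
-/

namespace AlmostUnary

open Cardinal Set

variable {X : Type u}

/-! ### Small sets -/

theorem IsSmall.mono {S T : Set X} (hT : IsSmall T) (h : S ⊆ T) : IsSmall S :=
  (mk_le_mk_of_subset h).trans_lt hT

theorem IsSmall.image {S : Set X} (hS : IsSmall S) (f : X → X) : IsSmall (f '' S) :=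
  mk_image_le.trans_lt hS

theorem IsSmall.union (hX : ℵ₀ ≤ #X) {S T : Set X} (hS : IsSmall S) (hT : IsSmall T) :
    IsSmall (S ∪ T) :=
  (mk_union_le S T).trans_lt (add_lt_of_lt hX hS hT)

theorem isSmall_of_finite (hX : ℵ₀ ≤ #X) {S : Set X} (hS : S.Finite) : IsSmall S :=
  hS.lt_aleph0.trans_le hX

theorem IsSmall.insert (hX : ℵ₀ ≤ #X) {S : Set X} (hS : IsSmall S) (a : X) :
    IsSmall (insert a S) :=
  (isSmall_of_finite hX (finite_singleton a)).union hX hS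

theorem not_isSmall_univ : ¬ IsSmall (univ : Set X) := by
  simp [IsSmall]

theorem IsSmall.biUnion (hreg : (#X).IsRegular) {S : Set X} (hS : IsSmall S) {F : X → Set X}
    (hF : ∀ a, IsSmall (F a)) : IsSmall (⋃ a ∈ S, F a) :=
  (card_biUnion_lt_iff_forall_of_isRegular hreg hS).2 fun a _ => hF a

theorem isSmall_iUnion_of_finite (hX : ℵ₀ ≤ #X) {ι : Type} [Finite ι] {F : ι → Set X}
    (hF : ∀ a, IsSmall (F a)) : IsSmall (⋃ a, F a) := by
  rw [← biUnion_univ]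
  refine Set.Finite.induction_on (motive := fun s _ => IsSmall (⋃ a ∈ s, F a)) univ finite_univ
    ?_ ?_
  · simpa using isSmall_of_finite hX finite_empty
  · intro a s _ _ ih
    rw [biUnion_insert]
    exact (hF a).union hX ih

section Order

variable [LinearOrder X]

theorem isSmall_Iic [WellFoundedLT X] (hX : ℵ₀ ≤ #X)
    (hord : Ordinal.type (fun x y : X => x < y) = (#X).ord) (y : X) : IsSmall (Iic y) := by
  rw [← Iio_insert]
  exact IsSmall.insert hX (mk_Iio_lt y hord.symm) y

theorem exists_lt_of_isSmall_Iic (hI : ∀ y : X, IsSmall (Iic y)) (y : X) : ∃ z, y < z := by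
  by_contra! h
  exact not_isSmall_univ ((hI y).mono fun z _ => h z)

/-- A subset of `X` is bounded if it is small: otherwise `X` would be a small union of small initial
segments. -/
theorem IsSmall.bddAbove (hreg : (#X).IsRegular) (hI : ∀ y : X, IsSmall (Iic y)) {S : Set X}
    (hS : IsSmall S) : BddAbove S := by
  by_contra h
  rw [not_bddAbove_iff] at h
  refine not_isSmall_univ ((hS.biUnion hreg hI).mono fun x _ => ?_)
  obtain ⟨s, hs, hxs⟩ := h x
  exact mem_biUnion hs hxs.le

/-! ### The second smallest entry -/

variable {n : ℕ} (hn : 2 ≤ n) (x : Fin n → X)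

theorem exists_ne_le_kthSmallest :
    ∃ i j, i ≠ j ∧ x i ≤ kthSmallest ⟨1, hn⟩ x ∧ x j ≤ kthSmallest ⟨1, hn⟩ x := by
  refine ⟨Tuple.sort x ⟨0, by omega⟩, Tuple.sort x ⟨1, hn⟩, ?_, ?_, le_rfl⟩
  · simp
  · exact Tuple.monotone_sort x (show (⟨0, _⟩ : Fin n) ≤ ⟨1, hn⟩ by simp)

theorem kthSmallest_le_max {i j : Fin n} (hij : i ≠ j) :
    kthSmallest ⟨1, hn⟩ x ≤ max (x i) (x j) := by
  have key : ∀ i : Fin n, (Tuple.sort x).symm i ≠ ⟨0, by omega⟩ → kthSmallest ⟨1, hn⟩ x ≤ x i := by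
    intro i hi
    have h : (⟨1, hn⟩ : Fin n) ≤ (Tuple.sort x).symm i := by
      rw [Fin.le_def]
      have : ((Tuple.sort x).symm i).val ≠ 0 := fun h => hi (Fin.ext h)
      change 1 ≤ _
      omega
    simpa [kthSmallest] using Tuple.monotone_sort x h
  by_cases hi : (Tuple.sort x).symm i = ⟨0, by omega⟩
  · refine le_max_of_le_right (key j fun hj => hij ?_)
    exact (Tuple.sort x).symm.injective (hi.trans hj.symm)
  · exact le_max_of_le_left (key i hi)

end Order

/-! ### Almost unary operations and clones -/

theorem IsClone.comp {C : Set (Op X)} (hC : IsClone C) {n m : ℕ} {f : (Fin n → X) → X}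
    {g : Fin n → (Fin m → X) → X} (hf : f ∈ arityPart C n) (hg : ∀ i, g i ∈ arityPart C m) :
    (fun x => f fun i => g i x) ∈ arityPart C m :=
  hC.comp_mem n m f g hf hg

theorem isAlmostUnary_proj (hX : ℵ₀ ≤ #X) {n : ℕ} (i : Fin n) :
    IsAlmostUnary fun x : Fin n → X => x i :=
  ⟨fun a => {a}, i, fun a => isSmall_of_finite hX (finite_singleton a), fun _ => rfl⟩

theorem IsAlmostUnary.comp (hreg : (#X).IsRegular) {n m : ℕ} {f : (Fin n → X) → X}
    {g : Fin n → (Fin m → X) → X} (hf : IsAlmostUnary f) (hg : ∀ i, IsAlmostUnary (g i)) :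
    IsAlmostUnary fun x => f fun i => g i x := by
  obtain ⟨F, k, hF, hfF⟩ := hf
  obtain ⟨G, l, hG, hgG⟩ := hg k
  exact ⟨fun a => ⋃ b ∈ G a, F b, l, fun a => (hG a).biUnion hreg hF,
    fun x => mem_biUnion (hgG x) (hfF fun i => g i x)⟩

theorem isClone_pol {J : Type u} (ρ : Set (J → X)) : IsClone (pol ρ) where
  subset_allOps _ hf := hf.1
  proj_mem n i := ⟨by have := i.isLt; change 1 ≤ n; omega, fun _ hr => hr i⟩
  comp_mem _ _ _ g hf hg :=
    ⟨(hg ⟨0, hf.1⟩).1, fun r hr => hf.2 (fun i j => g i fun k => r k j) fun i => (hg i).2 r hr⟩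

theorem comp_mem_of_binary {C : Set (Op X)} (hC : IsClone C) (hT : Sigma.mk 2 '' T₁ X ⊆ C) {m : ℕ}
    {F : X → Set X} (hF : ∀ a, IsSmall (F a)) {h : X → X → X} (hh : ∀ a b, h a b ∈ F a)
    {u v : (Fin m → X) → X} (hu : u ∈ arityPart C m) (hv : v ∈ arityPart C m) :
    (fun x => h (u x) (v x)) ∈ arityPart C m := by
  have h2 : (fun z : Fin 2 → X => h (z 0) (z 1)) ∈ arityPart C 2 :=
    hT ⟨_, ⟨F, 0, hF, fun z => hh _ _⟩, rfl⟩
  exact hC.comp (g := ![u, v]) h2 (by simp [Fin.forall_fin_two, hu, hv])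

/-- A clone containing `T₁` is closed under composition with almost unary operations. The induction
is on the number `n` of variables other than the dominating one. -/
theorem comp_mem_of_dominated [LinearOrder X] (hX : ℵ₀ ≤ #X) (hI : ∀ y : X, IsSmall (Iic y))
    {C : Set (Op X)} (hC : IsClone C) (hT : Sigma.mk 2 '' T₁ X ⊆ C) {m : ℕ} (n : ℕ) :
    ∀ {F : X → Set X}, (∀ a, IsSmall (F a)) → ∀ {g : X → (Fin n → X) → X},
      (∀ a b, g a b ∈ F a) → ∀ {u : (Fin m → X) → X}, u ∈ arityPart C m →
      ∀ {v : Fin n → (Fin m → X) → X}, (∀ i, v i ∈ arityPart C m) →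
      (fun x => g (u x) fun i => v i x) ∈ arityPart C m := by
  classical
  obtain ⟨e⟩ : Nonempty (X × Option X ≃ X) := by
    rw [← Cardinal.eq, mk_prod, mk_option, lift_id, lift_id,
      add_eq_left hX (one_le_aleph0.trans hX), mul_eq_self hX]
  induction n with
  | zero =>
    intro F hF g hg u hu v _
    have := comp_mem_of_binary hC hT hF (h := fun a _ => g a Fin.elim0) (fun _ _ => hg _ _) hu hu
    convert this using 4
  | succ n ih =>
    intro F hF g hg u hu v hv
    -- `code a b` encodes `a`, together with `b` if `b ≤ a`.
    let code : X → X → X := fun a b => e (a, if b ≤ a then some b else none)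
    let K : X → Set X := fun a => insert (e (a, none)) ((fun b => e (a, some b)) '' Iic a)
    have hK : ∀ a, IsSmall (K a) := fun a => ((hI a).image _).insert hX _
    have hcode : ∀ a b, code a b ∈ K a := by
      intro a b
      by_cases hab : b ≤ a
      · exact Or.inr ⟨b, hab, by simp [code, hab]⟩
      · exact Or.inl (by simp [code, hab])
    have hp := comp_mem_of_binary hC hT hK hcode hu (hv 0)
    have hq := comp_mem_of_binary hC hT hK hcode (hv 0) hu
    -- The case `v 0 x ≤ u x`; the value still carries `u x`.
    let g₁ : X → (Fin n → X) → X := fun c b =>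
      e ((e.symm c).1, (e.symm c).2.map fun d => g (e.symm c).1 (Fin.cons d b))
    have h₁ := ih (F := fun c => insert (e ((e.symm c).1, none))
        ((fun y => e ((e.symm c).1, some y)) '' F (e.symm c).1))
      (fun c => ((hF _).image _).insert hX _) (g := g₁)
      (by
        intro c b
        rcases hc : (e.symm c).2 with _ | d
        · exact Or.inl (by simp [g₁, hc])
        · exact Or.inr ⟨_, hg (e.symm c).1 (Fin.cons d b), by simp [g₁, hc]⟩)
      hp (fun i => hv i.succ)
    -- The case `u x < v 0 x`, with an irrelevant value otherwise.
    let g₂ : X → (Fin n → X) → X := fun c b =>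
      ((e.symm c).2.map fun d => g d (Fin.cons (e.symm c).1 b)).getD c
    have h₂ := ih (F := fun c => insert c (((e.symm c).2.map F).getD ∅))
      (fun c => by
        rcases (e.symm c).2 with _ | d
        · simpa using isSmall_of_finite hX (finite_singleton c)
        · simpa using (hF d).insert hX c)
      (g := g₂)
      (by
        intro c b
        rcases hc : (e.symm c).2 with _ | d
        · exact Or.inl (by simp [g₂, hc])
        · exact Or.inr (by simpa [g₂, hc] using hg d _))
      hq (fun i => hv i.succ)
    let join : X → X → X := fun p q =>
      (e.symm p).2.getD (if q ∈ F (e.symm p).1 then q else p)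
    have h₃ := comp_mem_of_binary hC hT
      (F := fun p => insert p (insert ((e.symm p).2.getD p) (F (e.symm p).1)))
      (fun p => ((hF _).insert hX _).insert hX _) (h := join)
      (by
        intro p q
        rcases hp : (e.symm p).2 with _ | d
        · by_cases hq : q ∈ F (e.symm p).1
          · simp [join, hp, hq]
          · simp [join, hp, hq]
        · simp [join, hp])
      h₁ h₂
    convert h₃ using 2 with x
    have hcons : (fun i => v i x) = Fin.cons (v 0 x) fun i : Fin n => v i.succ x := by
      ext i
      refine Fin.cases ?_ (fun i => ?_) i <;> simp
    rw [hcons]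
    by_cases hle : v 0 x ≤ u x
    · simp [join, g₁, code, hle]
    · simp [join, g₁, g₂, code, hle, (not_le.1 hle).le, hg]

theorem almostUnary_subset [LinearOrder X] (hX : ℵ₀ ≤ #X) (hI : ∀ y : X, IsSmall (Iic y))
    {C : Set (Op X)} (hC : IsClone C) (hT : Sigma.mk 2 '' T₁ X ⊆ C) : almostUnary X ⊆ C := by
  rintro ⟨n, f⟩ ⟨F, k, hF, hfF⟩
  classical
  have := comp_mem_of_dominated hX hI hC hT (m := n) n hF
    (g := fun a b => f (Function.update b k a))
    (fun a b => by simpa using hfF (Function.update b k a))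
    (hC.proj_mem n k) (fun i => hC.proj_mem n i)
  simp only [Function.update_eq_self] at this
  exact this

/-- A clone containing `T₁` contains every operation dominated by one of its members. -/
theorem mem_of_dominated [LinearOrder X] (hX : ℵ₀ ≤ #X) (hI : ∀ y : X, IsSmall (Iic y))
    {C : Set (Op X)} (hC : IsClone C) (hT : Sigma.mk 2 '' T₁ X ⊆ C) {n : ℕ} {f g : (Fin n → X) → X}
    (hg : g ∈ arityPart C n) {F : X → Set X} (hF : ∀ a, IsSmall (F a))
    (hfg : ∀ x, f x ∈ F (g x)) : f ∈ arityPart C n := by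
  classical
  -- `f x` is a function of `g x` and `x` that stays small in terms of its first argument alone.
  have := comp_mem_of_dominated hX hI hC hT (m := n) n (F := fun a => insert a (F a))
    (fun a => (hF a).insert hX a) (g := fun a b => if f b ∈ F a then f b else a)
    (fun a b => by by_cases h : f b ∈ F a <;> simp [h]) hg (fun i => hC.proj_mem n i)
  simpa [hfg] using this

/-! ### Controlling sets of variables -/

section Controls

variable [LinearOrder X]

/-- A set `S` of variables controls `f` if `f` takes only a small set of values when the variables
in `S` are bounded by a fixed element. -/
def Controls {N : ℕ} (S : Finset (Fin N)) (f : (Fin N → X) → X) : Prop :=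
  ∀ y, IsSmall (f '' {x | ∀ i ∈ S, x i ≤ y})

/-- If fewer than `n` sets of the family `𝓝` never cover all variables, then some member of the
clone avoids all sets in `𝓝`. -/
theorem exists_mem_avoids {C : Set (Op X)} (hC : IsClone C) {n : ℕ} (hn : 2 ≤ n)
    (hm : kthSmallest ⟨1, hn⟩ ∈ arityPart C n) {N : ℕ} (𝓝 : Finset (Finset (Fin N)))
    (h : ∀ 𝓢 ⊆ 𝓝, 𝓢.card < n → ∃ i, ∀ S ∈ 𝓢, i ∉ S) :
    ∃ g ∈ arityPart C N, ∀ S ∈ 𝓝, ∀ x, ∃ i ∉ S, x i ≤ g x := by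
  induction 𝓝 using Finset.strongInduction with
  | H 𝓝 ih =>
    by_cases hcard : 𝓝.card < n
    · obtain ⟨i, hi⟩ := h 𝓝 subset_rfl hcard
      exact ⟨fun x => x i, hC.proj_mem N i, fun S hS x => ⟨i, hi S hS, le_rfl⟩⟩
    · obtain ⟨T⟩ : Nonempty (Fin n ↪ 𝓝) :=
        Function.Embedding.nonempty_of_card_le (by simpa using hcard)
      have hT : ∀ j, ∃ g ∈ arityPart C N, ∀ S ∈ 𝓝.erase (T j), ∀ x, ∃ i ∉ S, x i ≤ g x :=
        fun j => ih _ (Finset.erase_ssubset (T j).2)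
          fun 𝓢 h𝓢 => h 𝓢 (h𝓢.trans (Finset.erase_subset _ _))
      choose g hgC hg using hT
      refine ⟨_, hC.comp hm hgC, fun S hS x => ?_⟩
      obtain ⟨j, k, hjk, hj, hk⟩ := exists_ne_le_kthSmallest hn fun j => g j x
      -- At most one of the `g j` fails to avoid `S`.
      have key : ∃ l, S ≠ T l ∧ g l x ≤ kthSmallest ⟨1, hn⟩ fun j => g j x := by
        by_cases hSj : S = T j
        · exact ⟨k, fun hSk => hjk (T.injective (Subtype.ext (hSj.symm.trans hSk))), hk⟩
        · exact ⟨j, hSj, hj⟩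
      obtain ⟨l, hl, hle⟩ := key
      obtain ⟨i, hi, hxi⟩ := hg l S (Finset.mem_erase.2 ⟨hl, hS⟩) x
      exact ⟨i, hi, hxi.trans hle⟩

/-- An operation belongs to the clone generated by `T₁` and the second smallest entry of `n`-tuples
if fewer than `n` sets that do not control it never cover all of its variables. -/
theorem mem_of_not_cover (hX : ℵ₀ ≤ #X) (hI : ∀ y : X, IsSmall (Iic y)) {C : Set (Op X)}
    (hC : IsClone C) (hT : Sigma.mk 2 '' T₁ X ⊆ C) {n : ℕ} (hn : 2 ≤ n)
    (hm : kthSmallest ⟨1, hn⟩ ∈ arityPart C n) {N : ℕ} (f : (Fin N → X) → X)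
    (h : ∀ 𝓢 : Finset (Finset (Fin N)), (∀ S ∈ 𝓢, ¬ Controls S f) → 𝓢.card < n →
      ∃ i, ∀ S ∈ 𝓢, i ∉ S) : f ∈ arityPart C N := by
  classical
  obtain ⟨g, hgC, hg⟩ := exists_mem_avoids hC hn hm
    (Finset.univ.filter fun S : Finset (Fin N) => ¬ Controls S f)
    (fun 𝓢 h𝓢 => h 𝓢 fun S hS => (Finset.mem_filter.1 (h𝓢 hS)).2)
  refine mem_of_dominated hX hI hC hT hgC
    (F := fun y => ⋃ S : {S : Finset (Fin N) // Controls S f}, f '' {x | ∀ i ∈ S.1, x i ≤ y})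
    (fun y => isSmall_iUnion_of_finite hX fun S => S.2 y) fun x => ?_
  have hS : Controls (Finset.univ.filter fun i => x i ≤ g x) f := by
    by_contra hS
    obtain ⟨i, hi, hxi⟩ := hg _ (Finset.mem_filter.2 ⟨Finset.mem_univ _, hS⟩) x
    exact hi (by simpa using hxi)
  exact mem_iUnion.2 ⟨⟨_, hS⟩, x, by simp, rfl⟩

theorem controls_univ (hX : ℵ₀ ≤ #X) (hI : ∀ y : X, IsSmall (Iic y)) {N : ℕ}
    (f : (Fin N → X) → X) : Controls Finset.univ f := by
  intro y
  let p : (Fin N → Iic y) → X := fun x => f fun i => x i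
  refine IsSmall.mono (T := range p) ?_ ?_
  · refine mk_range_le.trans_lt ?_
    rw [mk_arrow, lift_uzero, mk_fin, lift_natCast]
    rcases lt_or_ge #(Iic y) ℵ₀ with h | h
    · simpa using (power_lt_aleph0 h (natCast_lt_aleph0 (n := N))).trans_le hX
    · simpa using (power_nat_le h).trans_lt (hI y)
  · rintro _ ⟨x, hx, rfl⟩
    exact ⟨fun i => ⟨x i, hx i (Finset.mem_univ i)⟩, rfl⟩

theorem controls_kthSmallest (hI : ∀ y : X, IsSmall (Iic y)) {n : ℕ} (hn : 2 ≤ n)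
    {S : Finset (Fin n)} (hS : 1 < S.card) : Controls S (kthSmallest (X := X) ⟨1, hn⟩) := by
  obtain ⟨i, hi, j, hj, hij⟩ := Finset.one_lt_card.1 hS
  intro y
  refine (hI y).mono ?_
  rintro _ ⟨x, hx, rfl⟩
  exact (kthSmallest_le_max hn x hij).trans (max_le (hx i hi) (hx j hj))

theorem exists_injective_of_not_controls {N : ℕ} {S : Finset (Fin N)} {f : (Fin N → X) → X}
    (h : ¬ Controls S f) :
    ∃ (y : X) (w : X → Fin N → X), (∀ z, ∀ i ∈ S, w z i ≤ y) ∧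
      Function.Injective fun z => f (w z) := by
  simp only [Controls, not_forall] at h
  obtain ⟨y, hy⟩ := h
  obtain ⟨e⟩ := not_lt.1 hy
  choose w hw hfw using fun z => (e z).2
  refine ⟨y, w, hw, fun a b hab => e.injective (Subtype.ext ?_)⟩
  simpa only [hfw] using hab

/-- Two sets of variables that do not control an operation in `Pol T₁` do not cover its
variables. -/
theorem exists_notMem_of_mem_pol (hX : ℵ₀ ≤ #X) (hI : ∀ y : X, IsSmall (Iic y)) {N : ℕ}
    {f : (Fin N → X) → X} (hf : (⟨N, f⟩ : Op X) ∈ pol (T₁ X)) {S T : Finset (Fin N)}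
    (hS : ¬ Controls S f) (hT : ¬ Controls T f) : ∃ i, i ∉ S ∧ i ∉ T := by
  classical
  by_contra! hcov
  obtain ⟨y₀, w₀, hw₀, hi₀⟩ := exists_injective_of_not_controls hS
  obtain ⟨y₁, w₁, hw₁, hi₁⟩ := exists_injective_of_not_controls hT
  obtain ⟨o⟩ : Nonempty X := mk_ne_zero_iff.1 (aleph0_pos.trans_le hX).ne'
  -- With `o` in one argument, the `g i` run through tuples bounded on `S` (on `T`, respectively),
  -- on which `f` takes `#X` values.
  let g : Fin N → (Fin 2 → X) → X := fun i x =>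
    if x 0 = o then w₀ (x 1) i else if x 1 = o then w₁ (x 0) i else o
  have hg : ∀ i, g i ∈ T₁ X := by
    intro i
    by_cases hi : i ∈ S
    · refine ⟨fun a => insert (w₁ a i) (insert o (Iic y₀)), 0,
        fun a => ((hI y₀).insert hX _).insert hX _, fun x => ?_⟩
      by_cases h0 : x 0 = o
      · simp [g, h0, hw₀ _ i hi]
      · by_cases h1 : x 1 = o <;> simp [g, h0, h1]
    · refine ⟨fun a => insert (w₀ a i) (insert o (Iic y₁)), 1,
        fun a => ((hI y₁).insert hX _).insert hX _, fun x => ?_⟩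
      by_cases h0 : x 0 = o
      · simp [g, h0]
      · by_cases h1 : x 1 = o <;> simp [g, h0, h1, hw₁ _ i (hcov i hi)]
  obtain ⟨F, k, hF, hfF⟩ := hf.2 g hg
  -- Each argument of `f (g₁, …, g_N)` thus fails to bound the value when it equals `o`.
  have contra : ∀ w : X → Fin N → X, (Function.Injective fun z => f (w z)) →
      (∀ z, z ≠ o → f (w z) ∈ F o) → False := by
    intro w hw h
    have hsm : IsSmall (range fun z => f (w z)) := by
      refine ((hF o).insert hX (f (w o))).mono ?_
      rintro _ ⟨z, rfl⟩
      by_cases hz : z = o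
      · exact Or.inl (by rw [hz])
      · exact Or.inr (h z hz)
    exact absurd (mk_range_eq _ hw) hsm.ne
  fin_cases k
  · exact contra w₀ hi₀ fun z _ => by simpa [g] using hfF ![o, z]
  · exact contra w₁ hi₁ fun z hz => by simpa [g, hz] using hfF ![z, o]

/-! ### The clones `M n` -/

theorem generators_subset_allOps {n : ℕ} (hn : 2 ≤ n) :
    ({(⟨n, kthSmallest ⟨1, hn⟩⟩ : Op X)} ∪ Sigma.mk 2 '' T₁ X) ⊆ allOps X := by
  rintro f (rfl | ⟨f, _, rfl⟩)
  · exact (show 1 ≤ 2 by norm_num).trans hn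
  · exact show 1 ≤ 2 by norm_num

theorem isClone_M {n : ℕ} (hn : 2 ≤ n) : IsClone (M X n hn) :=
  isClone_cloneGen (generators_subset_allOps hn)

theorem T₁_subset_M {n : ℕ} (hn : 2 ≤ n) : Sigma.mk 2 '' T₁ X ⊆ M X n hn :=
  fun _ hf => mem_sInter.2 fun _ hC => hC.2 (Or.inr hf)

theorem kthSmallest_mem_M {n : ℕ} (hn : 2 ≤ n) : kthSmallest ⟨1, hn⟩ ∈ arityPart (M X n hn) n :=
  mem_sInter.2 fun _ hC => hC.2 (Or.inl rfl)

theorem M_subset {n : ℕ} (hn : 2 ≤ n) {C : Set (Op X)} (hC : IsClone C)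
    (hm : kthSmallest ⟨1, hn⟩ ∈ arityPart C n) (hT : Sigma.mk 2 '' T₁ X ⊆ C) : M X n hn ⊆ C := by
  refine sInter_subset_of_mem ⟨hC, ?_⟩
  rintro f (rfl | hf)
  · exact hm
  · exact hT hf

theorem isAlmostUnary_kthSmallest_comp (hreg : (#X).IsRegular) (hI : ∀ y : X, IsSmall (Iic y))
    {k n : ℕ} (hn : 2 ≤ n) (hk : k < n) {g : Fin n → (Fin k → X) → X}
    (hg : ∀ i, IsAlmostUnary (g i)) :
    IsAlmostUnary fun x => kthSmallest ⟨1, hn⟩ fun i => g i x := by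
  choose F c hF hgF using hg
  obtain ⟨i, j, hij, hc⟩ := Fintype.exists_ne_map_eq_of_card_lt c (by simpa using hk)
  refine ⟨fun a => ⋃ b ∈ F i a ∪ F j a, Iic b, c i,
    fun a => ((hF i a).union hreg.aleph0_le (hF j a)).biUnion hreg hI, fun x => ?_⟩
  rcases le_max_iff.1 (kthSmallest_le_max hn (fun i => g i x) hij) with h | h
  · exact mem_biUnion (Or.inl (hgF i x)) h
  · exact mem_biUnion (Or.inr (hc ▸ hgF j x)) h

theorem M_subset_pol (hreg : (#X).IsRegular) (hI : ∀ y : X, IsSmall (Iic y)) {k n : ℕ}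
    (hn : 2 ≤ n) (hk : k < n) : M X n hn ⊆ pol (arityPart (almostUnary X) k) := by
  refine M_subset hn (isClone_pol _) ⟨generators_subset_allOps hn (Or.inl rfl), fun r hr => ?_⟩ ?_
  · exact isAlmostUnary_kthSmallest_comp hreg hI hn hk hr
  · rintro _ ⟨f, hf, rfl⟩
    have hf' : IsAlmostUnary f := hf
    exact ⟨show 1 ≤ 2 by norm_num, fun r hr => hf'.comp hreg hr⟩

theorem arityPart_M (hreg : (#X).IsRegular) (hI : ∀ y : X, IsSmall (Iic y)) {k n : ℕ} (hn : 2 ≤ n)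
    (hk : k < n) : arityPart (M X n hn) k = arityPart (almostUnary X) k := by
  refine Subset.antisymm (fun f hf => ?_) fun f hf =>
    almostUnary_subset hreg.aleph0_le hI (isClone_M hn) (T₁_subset_M hn) hf
  exact (M_subset_pol hreg hI hn hk hf).2 (fun i x => x i) fun i =>
    isAlmostUnary_proj hreg.aleph0_le i

theorem M_two (hX : ℵ₀ ≤ #X) (hI : ∀ y : X, IsSmall (Iic y)) : M X 2 le_rfl = allOps X := by
  refine (isClone_M le_rfl).subset_allOps.antisymm ?_
  rintro ⟨N, f⟩ (hN : 1 ≤ N)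
  refine mem_of_not_cover hX hI (isClone_M _) (T₁_subset_M _) le_rfl (kthSmallest_mem_M _) f
    fun 𝓢 h𝓢 hcard => ?_
  by_contra! hcov
  obtain ⟨S, hS, -⟩ := hcov ⟨0, hN⟩
  -- A one-element cover consists of the set of all variables.
  have hu : S = Finset.univ := by
    refine Finset.eq_univ_of_forall fun i => ?_
    obtain ⟨T, hT, hi⟩ := hcov i
    rwa [Finset.card_le_one.1 (Nat.lt_succ_iff.1 hcard) S hS T hT]
  exact h𝓢 S hS (hu ▸ controls_univ hX hI f)

theorem M_three (hreg : (#X).IsRegular) (hI : ∀ y : X, IsSmall (Iic y)) :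
    M X 3 (by norm_num) = pol (T₁ X) := by
  refine (M_subset_pol hreg hI _ (by norm_num)).antisymm ?_
  rintro ⟨N, f⟩ hf
  refine mem_of_not_cover hreg.aleph0_le hI (isClone_M _) (T₁_subset_M _) _ (kthSmallest_mem_M _) f
    fun 𝓢 h𝓢 hcard => ?_
  rcases 𝓢.eq_empty_or_nonempty with rfl | ⟨S, hS⟩
  · exact ⟨⟨0, hf.1⟩, by simp⟩
  · have hle : (𝓢.erase S).card ≤ 1 := by
      rw [Finset.card_erase_of_mem hS]
      omega
    -- The family is contained in some `{S, T}`, possibly with `T = S`.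
    have hT : ∃ T ∈ 𝓢, ∀ R ∈ 𝓢, R = S ∨ R = T := by
      rcases (𝓢.erase S).eq_empty_or_nonempty with he | ⟨T, hT⟩
      · refine ⟨S, hS, fun R hR => ?_⟩
        by_contra! hne
        simpa [he] using Finset.mem_erase.2 ⟨hne.1, hR⟩
      · refine ⟨T, Finset.mem_of_mem_erase hT, fun R hR => or_iff_not_imp_left.2 fun hne => ?_⟩
        exact Finset.card_le_one.1 hle R (Finset.mem_erase.2 ⟨hne, hR⟩) T hT
    obtain ⟨T, hT, hST⟩ := hT
    obtain ⟨i, hiS, hiT⟩ :=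
      exists_notMem_of_mem_pol hreg.aleph0_le hI hf (h𝓢 S hS) (h𝓢 T hT)
    refine ⟨i, fun R hR => ?_⟩
    rcases hST R hR with rfl | rfl <;> assumption

theorem M_succ_subset (hX : ℵ₀ ≤ #X) (hI : ∀ y : X, IsSmall (Iic y)) {n : ℕ} (hn : 2 ≤ n) :
    M X (n + 1) (Nat.le_succ_of_le hn) ⊆ M X n hn := by
  refine M_subset _ (isClone_M hn) ?_ (T₁_subset_M hn)
  refine mem_of_not_cover hX hI (isClone_M hn) (T₁_subset_M hn) hn (kthSmallest_mem_M hn) _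
    fun 𝓢 h𝓢 hcard => ?_
  by_contra! hcov
  -- Non-controlling sets have at most one element, so fewer than `n` of them cover fewer than `n`
  -- of the `n + 1` variables.
  have h1 : (𝓢.biUnion id).card ≤ 𝓢.card * 1 := Finset.card_biUnion_le_card_mul _ _ _ fun S hS =>
    not_lt.1 fun h => h𝓢 S hS (controls_kthSmallest hI _ h)
  have h2 : 𝓢.biUnion id = Finset.univ := Finset.eq_univ_of_forall fun i => by
    simpa using hcov i
  rw [h2, Finset.card_univ, Fintype.card_fin] at h1
  omega

theorem not_isAlmostUnary_kthSmallest (hreg : (#X).IsRegular) (hI : ∀ y : X, IsSmall (Iic y))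
    {n : ℕ} (hn : 2 ≤ n) : ¬ IsAlmostUnary (kthSmallest (X := X) ⟨1, hn⟩) := by
  rintro ⟨F, k, hF, hfF⟩
  obtain ⟨o⟩ : Nonempty X := mk_ne_zero_iff.1 (aleph0_pos.trans_le hreg.aleph0_le).ne'
  obtain ⟨b, hb⟩ := (hF o).bddAbove hreg hI
  obtain ⟨y, hy⟩ := exists_lt_of_isSmall_Iic hI b
  -- All entries but the `k`-th equal `y`, so the second smallest entry is at least `y`.
  have hmem := hfF (Function.update (fun _ => y) k o)
  rw [Function.update_self] at hmem
  obtain ⟨i, j, hij, hi, hj⟩ := exists_ne_le_kthSmallest hn (Function.update (fun _ => y) k o)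
  have key : ∀ l, l ≠ k → ¬ Function.update (fun _ => y) k o l ≤
      kthSmallest ⟨1, hn⟩ (Function.update (fun _ => y) k o) := by
    intro l hl hle
    rw [Function.update_of_ne hl] at hle
    exact (hy.trans_le (hle.trans (hb hmem))).false
  by_cases hik : i = k
  · exact key j (fun hjk => hij (hik.trans hjk.symm)) hj
  · exact key i hik hi

theorem M_succ_ssubset (hreg : (#X).IsRegular) (hI : ∀ y : X, IsSmall (Iic y)) {n : ℕ}
    (hn : 2 ≤ n) : M X (n + 1) (Nat.le_succ_of_le hn) ⊂ M X n hn := by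
  refine ⟨M_succ_subset hreg.aleph0_le hI hn, fun h => not_isAlmostUnary_kthSmallest hreg hI hn ?_⟩
  have : kthSmallest ⟨1, hn⟩ ∈ arityPart (M X (n + 1) (Nat.le_succ_of_le hn)) n :=
    h (kthSmallest_mem_M hn)
  rwa [arityPart_M hreg hI _ n.lt_succ_self] at this

theorem iInter_M (hreg : (#X).IsRegular) (hI : ∀ y : X, IsSmall (Iic y)) :
    (⋂ (n : ℕ) (hn : 2 ≤ n), M X n hn) = almostUnary X := by
  refine Subset.antisymm ?_ (subset_iInter₂ fun n hn =>
    almostUnary_subset hreg.aleph0_le hI (isClone_M hn) (T₁_subset_M hn))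
  rintro ⟨k, f⟩ hf
  have hk : f ∈ arityPart (M X (k + 2) (by omega)) k := mem_iInter₂.1 hf (k + 2) (by omega)
  rwa [arityPart_M hreg hI _ (by omega)] at hk

end Controls

end AlmostUnary

theorem mainTheorem2 {X : Type u} [LinearOrder X] [WellFoundedLT X]
    (hreg : (Cardinal.mk X).IsRegular)
    (hord : Ordinal.type (fun x y : X => x < y) = (Cardinal.mk X).ord) :
    AlmostUnary.M X 2 le_rfl = AlmostUnary.allOps X ∧
    AlmostUnary.M X 3 (by norm_num) = AlmostUnary.pol (AlmostUnary.T₁ X) ∧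
    (∀ (n : ℕ) (hn : 2 ≤ n),
      AlmostUnary.M X (n + 1) (Nat.le_succ_of_le hn) ⊂ AlmostUnary.M X n hn) ∧
    (⋂ (n : ℕ) (hn : 2 ≤ n), AlmostUnary.M X n hn) = AlmostUnary.almostUnary X ∧
    (∀ (n : ℕ) (hn : 2 ≤ n) (k : ℕ), 1 ≤ k → k < n →
      AlmostUnary.arityPart (AlmostUnary.M X n hn) k =
        AlmostUnary.arityPart (AlmostUnary.almostUnary X) k) := by
  have hI := AlmostUnary.isSmall_Iic hreg.aleph0_le hord
  exact ⟨AlmostUnary.M_two hreg.aleph0_le hI, AlmostUnary.M_three hreg hI,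
    fun n hn => AlmostUnary.M_succ_ssubset hreg hI hn, AlmostUnary.iInter_M hreg hI,
    fun n hn k _ hk => AlmostUnary.arityPart_M hreg hI hn hk⟩
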